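/- **Theorem 3.2.** For $p,q\in\mathbb R$ let $\Psi_{p,q}$ be the linear map on complex $3\times3$ matrices $Z=[z_{ij}]_{i,j=0}^{2}$ given by $$\Psi_{p,q}(Z)=\begin{bmatrix} p^2(pq-1)^2z_{00}+q(2p-q)z_{11} & a\,z_{01} & b\,z_{02}\\ a\,z_{10} & p^2q^3(2p-q)z_{00}+q^2(pq-1)^2z_{11}+q(2p-q)z_{22} & a\,z_{12}\\ b\,z_{20} & a\,z_{21} & q(2p-q)(1-p^2q^2)z_{00}+p^2q^3(2p-q)z_{11}+p^2(pq-1)^2z_{22}\end{bmatrix},$$ where $a=-pq(1-q^2+p^2q^2)$ and $b=(pq-1)(p^2+pq-p^3q-q^2+p^2q^2)$. Let $$\mathcal R=\{(p,q)\in(0,1/\sqrt2)\times(0,\sqrt2)\;:\;2p-q\ge 0,\ (p^2-1)^2q^2-p^2\ge 0\}.$$ A self-adjointness-preserving linear map $\Phi$ between complex matrix algebras is called positive if it maps positive semidefinite matrices to positive semidefinite matrices; completely positive if $\Phi\otimes\mathrm{Id}_{M_k}$ is positive for every $k$; and co-completely positive if $T\circ\Phi$ is completely positive, where $T$ is the transposition.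 A positive map $\Phi\neq0$ is extreme if whenever $\Phi=\Phi_1+\Phi_2$ with $\Phi_1,\Phi_2$ positive, both $\Phi_1$ and $\Phi_2$ are nonnegative real multiples of $\Phi$. The Kraus rank of a completely positive $\Phi$ is the least $K$ for which there are matrices $A_1,\dots,A_K$ with $\Phi(Z)=\sum_{k=1}^K A_kZA_k^\dagger$ for all $Z$. Then for every $(p,q)\in\mathcal R$: 1. $\Psi_{p,q}$ is an extreme positive map; 2. if $q\neq 2p$, then $\Psi_{p,q}$ is neither completely positive nor co-completely positive; 3. if $q=2p$, then $\Psi_{p,q}$ is completely positive of Kraus rank $1$. -/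

import Mathlib

open scoped ComplexOrder Matrix Kronecker

noncomputable section

namespace QuantumMap

variable {m n : Type*}

/-- The ampliation `Φ ⊗ id` of a linear map of matrices, on `Mₙ(ℂ) ⊗ M_ι(ℂ) = M_{n × ι}(ℂ)`:
the map `Φ` is applied to each of the `ι × ι` blocks. -/
def ampliation (ι : Type*) (Φ : Matrix n n ℂ →ₗ[ℂ] Matrix m m ℂ) :
    Matrix (n × ι) (n × ι) ℂ →ₗ[ℂ] Matrix (m × ι) (m × ι) ℂ where
  toFun M := Matrix.of fun r s =>
    Φ (Matrix.of fun k l => M (k, r.2) (l, s.2)) r.1 s.1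
  map_add' M N := by
    ext r s
    exact congrFun (congrFun (Φ.map_add (Matrix.of fun k l => M (k, r.2) (l, s.2))
      (Matrix.of fun k l => N (k, r.2) (l, s.2))) r.1) s.1
  map_smul' c M := by
    ext r s
    exact congrFun (congrFun (Φ.map_smul c (Matrix.of fun k l => M (k, r.2) (l, s.2))) r.1) s.1

/-- `Φ ⊗ id` sends `A ⊗ B` to `Φ A ⊗ B`. -/
theorem ampliation_kronecker {ι : Type*} (Φ : Matrix n n ℂ →ₗ[ℂ] Matrix m m ℂ)
    (A : Matrix n n ℂ) (B : Matrix ι ι ℂ) :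
    ampliation ι Φ (A ⊗ₖ B) = Φ A ⊗ₖ B := by
  ext r s
  have h : (Matrix.of fun k l => (A ⊗ₖ B) (k, r.2) (l, s.2)) = B r.2 s.2 • A := by
    ext k l
    simp [mul_comm]
  change Φ (Matrix.of fun k l => (A ⊗ₖ B) (k, r.2) (l, s.2)) r.1 s.1 = _
  rw [h, map_smul]
  simp [mul_comm]

/-- A positive map: a self-adjointness-preserving linear map of matrices (equivalently, the
complexification of a real-linear map between self-adjoint matrices) that sends positive
semidefinite matrices to positive semidefinite matrices. -/
def IsPositive (Φ : Matrix n n ℂ →ₗ[ℂ] Matrix m m ℂ) : Prop :=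
  (∀ Z : Matrix n n ℂ, Φ Zᴴ = (Φ Z)ᴴ) ∧
    ∀ Z : Matrix n n ℂ, Z.PosSemidef → (Φ Z).PosSemidef

/-- An extreme positive map: a nonzero element of an extreme ray of the cone of positive maps. -/
def IsExtremePositive (Φ : Matrix n n ℂ →ₗ[ℂ] Matrix m m ℂ) : Prop :=
  IsPositive Φ ∧ Φ ≠ 0 ∧
    ∀ Φ₁ Φ₂ : Matrix n n ℂ →ₗ[ℂ] Matrix m m ℂ, IsPositive Φ₁ → IsPositive Φ₂ → Φ = Φ₁ + Φ₂ →
      ∃ a b : ℝ, 0 ≤ a ∧ 0 ≤ b ∧ Φ₁ = (a : ℂ) • Φ ∧ Φ₂ = (b : ℂ) • Φ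

/-- `Φ` is completely positive: `Φ ⊗ id` is positive on `Mₙ(ℂ) ⊗ M_k(ℂ)` for every `k`. -/
def IsCompletelyPositive (Φ : Matrix n n ℂ →ₗ[ℂ] Matrix m m ℂ) : Prop :=
  ∀ k : ℕ, IsPositive (ampliation (Fin k) Φ)

/-- `Φ` is co-completely positive: `T ∘ Φ` is completely positive, `T` being the transposition. -/
def IsCoCompletelyPositive (Φ : Matrix n n ℂ →ₗ[ℂ] Matrix m m ℂ) : Prop :=
  IsCompletelyPositive ((Matrix.transposeLinearEquiv m m ℂ ℂ).toLinearMap ∘ₗ Φ)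

/-- `Φ` has a Kraus decomposition `Φ Z = ∑ₖ Aₖ Z Aₖ†` with `K` terms. -/
def HasKrausDecomposition [Fintype n] (Φ : Matrix n n ℂ →ₗ[ℂ] Matrix m m ℂ) (K : ℕ) : Prop :=
  ∃ A : Fin K → Matrix m n ℂ, ∀ Z : Matrix n n ℂ, Φ Z = ∑ k, A k * Z * (A k)ᴴ

/-- The Kraus rank of `Φ` is `K`: the least number of terms in a Kraus decomposition is `K`. -/
def IsKrausRank [Fintype n] (Φ : Matrix n n ℂ →ₗ[ℂ] Matrix m m ℂ) (K : ℕ) : Prop :=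
  IsLeast {K : ℕ | HasKrausDecomposition Φ K} K

/-- The two-parameter map `Ψ_{p,q}` on complex `3 × 3` matrices. -/
def Psi (p q : ℝ) : Matrix (Fin 3) (Fin 3) ℂ →ₗ[ℂ] Matrix (Fin 3) (Fin 3) ℂ where
  toFun Z :=
    !![p ^ 2 * (p * q - 1) ^ 2 * Z 0 0 + q * (2 * p - q) * Z 1 1,
       -p * q * (1 - q ^ 2 + p ^ 2 * q ^ 2) * Z 0 1,
       (p * q - 1) * (p ^ 2 + p * q - p ^ 3 * q - q ^ 2 + p ^ 2 * q ^ 2) * Z 0 2;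
       -p * q * (1 - q ^ 2 + p ^ 2 * q ^ 2) * Z 1 0,
       p ^ 2 * q ^ 3 * (2 * p - q) * Z 0 0 + q ^ 2 * (p * q - 1) ^ 2 * Z 1 1
         + q * (2 * p - q) * Z 2 2,
       -p * q * (1 - q ^ 2 + p ^ 2 * q ^ 2) * Z 1 2;
       (p * q - 1) * (p ^ 2 + p * q - p ^ 3 * q - q ^ 2 + p ^ 2 * q ^ 2) * Z 2 0,
       -p * q * (1 - q ^ 2 + p ^ 2 * q ^ 2) * Z 2 1,
       q * (2 * p - q) * (1 - p ^ 2 * q ^ 2) * Z 0 0 + p ^ 2 * q ^ 3 * (2 * p - q) * Z 1 1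
         + p ^ 2 * (p * q - 1) ^ 2 * Z 2 2]
  map_add' Z W := by
    ext i j
    fin_cases i <;> fin_cases j <;> simp <;> ring
  map_smul' c Z := by
    ext i j
    fin_cases i <;> fin_cases j <;> simp <;> ring

/-- The parameter region. -/
def region : Set (ℝ × ℝ) :=
  {x | x.1 ∈ Set.Ioo 0 (1 / √2) ∧ x.2 ∈ Set.Ioo 0 √2 ∧
    0 ≤ 2 * x.1 - x.2 ∧ 0 ≤ (x.1 ^ 2 - 1) ^ 2 * x.2 ^ 2 - x.1 ^ 2}

end QuantumMap

end

/-! Positivity. Since positive semidefinite matrices are sums of `x x†`, it suffices to check the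
principal minors of `Ψ(x x†)`. The phases of `x` drop out, so these are polynomials in `u, v, w =
|xᵢ|²`. The `2 × 2` minors are visibly nonnegative, and the determinant is a nonnegative constant
times `cubic`. This cubic has a node at `(1, 1, 1)` with semidefinite Hessian, so subtracting the
least variable only decreases it and leads to a face of the octant, where it factors
(`cubic_nonneg`).

Extremality. The form `y† Φ(x x†) y` of `Ψ` vanishes on four orbits of the torus of diagonal
unitaries. If `Ψ = Φ₁ + Φ₂`, both nonnegative forms vanish there too, and so do their derivatives in
`x` and `y`. Fourier analysis along the orbits splits these equations by weight. They kill every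
coefficient that is not invariant under the torus (`HasPsiZeros.coeff_eq_zero`) and leave a linear
system with a one-dimensional solution space for the others (`exists_eq_mul_of_system`).

Complete positivity. Off the line `q = 2p`, a `2 × 2` principal minor of the Choi matrix is
negative, with or without the transposition; on that line a single diagonal Kraus operator gives
`Ψ`. -/

namespace QuantumMap

/-! ### Nonnegativity of the determinant cubic -/

/-- The cubic that remains of `det Ψ(x x†)` in the variables `|xᵢ|²` once its constant factors
are removed. -/
def cubic (p q u v w : ℝ) : ℝ :=
  p ^ 2 * v * w ^ 2 - 2 * p ^ 2 * q ^ 2 * v ^ 2 * w + p ^ 2 * q ^ 4 * v ^ 3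
    + (q ^ 2 * (1 - p ^ 2) ^ 2 - p ^ 2) * u * w ^ 2
    + (-p ^ 6 * q ^ 4 + 2 * p ^ 4 * q ^ 4 - p ^ 2 * q ^ 4 + 6 * p ^ 2 * q ^ 2 - p ^ 2 - 2 * q ^ 2)
      * u * v * w
    + q ^ 2 * (-2 * p ^ 4 * q ^ 2 - p ^ 2 * q ^ 2 + 1) * u * v ^ 2
    + p ^ 2 * (p ^ 4 * q ^ 4 - 2 * p ^ 2 * q ^ 4 - 2 * p ^ 2 * q ^ 2 + q ^ 4 + 1) * u ^ 2 * w
    + p ^ 2 * q ^ 2 * (p ^ 4 * q ^ 2 + 2 * p ^ 2 * q ^ 2 - 2) * u ^ 2 * v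
    + p ^ 4 * q ^ 2 * (1 - p ^ 2 * q ^ 2) * u ^ 3

/-- Half the Hessian of `cubic` at its node `(1, 1, 1)`. -/
def nodeForm (p q u v w : ℝ) : ℝ :=
  q ^ 2 * (1 - p ^ 2) ^ 2 * w ^ 2
    + q ^ 2 * (-2 * p ^ 4 * q ^ 2 + 2 * p ^ 2 * q ^ 2 - 2 * p ^ 2 + 1) * v ^ 2
    + p ^ 2 * (-p ^ 4 * q ^ 4 + p ^ 2 * q ^ 2 + q ^ 4 - 2 * q ^ 2 + 1) * u ^ 2
    + p ^ 2 * (p ^ 4 * q ^ 4 - 2 * p ^ 2 * q ^ 4 - 2 * p ^ 2 * q ^ 2 + q ^ 4 + 2 * q ^ 2 - 1) * u * w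
    + p ^ 2 * (p ^ 4 * q ^ 4 + 2 * p ^ 2 * q ^ 4 - 3 * q ^ 4 + 2 * q ^ 2 - 1) * u * v
    + (-p ^ 6 * q ^ 4 + 2 * p ^ 4 * q ^ 4 - p ^ 2 * q ^ 4 + 2 * p ^ 2 * q ^ 2 + p ^ 2 - 2 * q ^ 2)
      * v * w

/-- The terms in `m ^ 2` and `m ^ 3` are absent because the cubic and its gradient vanish at `(1, 1,
1)`. -/
theorem cubic_add_node (p q m u v w : ℝ) :
    cubic p q (m + u) (m + v) (m + w) = cubic p q u v w + m * nodeForm p q u v w := by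
  unfold cubic nodeForm
  ring

/-- The inequalities on the parameters that the proofs use. -/
structure Admissible (p q : ℝ) : Prop where
  p_pos : 0 < p
  q_pos : 0 < q
  pq_lt : p * q < 1
  le_two_mul : q ≤ 2 * p
  p_sq_lt : p ^ 2 < 1 / 2
  q_sq_lt : q ^ 2 < 2
  p_le : p ≤ q * (1 - p ^ 2)

theorem admissible_of_mem_region {p q : ℝ} (h : (p, q) ∈ region) : Admissible p q := by
  obtain ⟨⟨hp, hp'⟩, ⟨hq, hq'⟩, h1, h2⟩ := h
  simp only at hp hp' hq hq' h1 h2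
  have hs : 0 < √(2 : ℝ) := by positivity
  have hs2 : √(2 : ℝ) ^ 2 = 2 := Real.sq_sqrt (by norm_num)
  have hps : p * √2 < 1 := by rwa [lt_div_iff₀ hs] at hp'
  have hp2 : p ^ 2 < 1 / 2 := by
    have : (p * √2) ^ 2 < 1 := by
      rw [sq_lt_one_iff_abs_lt_one, abs_of_pos (by positivity)]
      exact hps
    rw [mul_pow, hs2] at this
    linarith
  refine ⟨hp, hq, ?_, by linarith, hp2, ?_, ?_⟩
  · exact (mul_lt_mul_of_pos_left hq' hp).trans hps
  · rw [← hs2]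
    exact pow_lt_pow_left₀ hq' hq.le (by norm_num)
  · refine (sq_le_sq₀ hp.le (mul_nonneg hq.le (by linarith))).1 ?_
    nlinarith

namespace Admissible

variable {p q : ℝ} (h : Admissible p q)
include h

theorem pq_pos : 0 < p * q := mul_pos h.p_pos h.q_pos

theorem p_sq_le : p ^ 2 ≤ q ^ 2 * (1 - p ^ 2) ^ 2 := by
  have := pow_le_pow_left₀ h.p_pos.le h.p_le 2
  rwa [mul_pow] at this

theorem pq_sq_lt : p ^ 2 * q ^ 2 < 1 := by
  rw [← mul_pow]
  exact pow_lt_one₀ h.pq_pos.le h.pq_lt (by norm_num)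

/-- By Euler's relation `(1, 1, 1)` lies in the radical of the form. After completing the square in
`w`, the remainder is therefore a multiple of `(u - v) ^ 2`; `hJ` gives the sign of its nontrivial
factor. -/
theorem nodeForm_nonneg (u v w : ℝ) : 0 ≤ nodeForm p q u v w := by
  have hk := h.p_sq_le
  have hq := h.q_pos
  have hp : 0 < 1 - p ^ 2 := by linarith [h.p_sq_lt]
  have hX : q ^ 2 * (1 - p ^ 2) ≤ 3 := by
    nlinarith [h.q_sq_lt, h.p_sq_lt, sq_nonneg q, sq_nonneg p, mul_nonneg (sq_nonneg q) (sq_nonneg p)]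
  have hJ : 0 ≤ 4 * (q ^ 2 * (1 - p ^ 2) ^ 2 - p ^ 2)
      + p ^ 2 * (3 - q ^ 2 * (1 - p ^ 2)) * (1 + q ^ 2 * (1 - p ^ 2)) := by
    have h3 : 0 ≤ 3 - q ^ 2 * (1 - p ^ 2) := by linarith
    have h4 : 0 ≤ q ^ 2 * (1 - p ^ 2) ^ 2 - p ^ 2 := by linarith
    positivity
  have hid : 4 * (q ^ 2 * (1 - p ^ 2) ^ 2) * nodeForm p q u v w =
      (2 * (q ^ 2 * (1 - p ^ 2) ^ 2) * w
        + p ^ 2 * (p ^ 4 * q ^ 4 - 2 * p ^ 2 * q ^ 4 - 2 * p ^ 2 * q ^ 2 + q ^ 4 + 2 * q ^ 2 - 1) * u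
        + (-p ^ 6 * q ^ 4 + 2 * p ^ 4 * q ^ 4 - p ^ 2 * q ^ 4 + 2 * p ^ 2 * q ^ 2 + p ^ 2
          - 2 * q ^ 2) * v) ^ 2
      + p ^ 2 * (1 - q ^ 2 + p ^ 2 * q ^ 2) ^ 2
        * (4 * (q ^ 2 * (1 - p ^ 2) ^ 2 - p ^ 2)
          + p ^ 2 * (3 - q ^ 2 * (1 - p ^ 2)) * (1 + q ^ 2 * (1 - p ^ 2))) * (u - v) ^ 2 := by
    unfold nodeForm
    ring
  have hpos : 0 < 4 * (q ^ 2 * (1 - p ^ 2) ^ 2) := by positivity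
  refine nonneg_of_mul_nonneg_right (b := nodeForm p q u v w) ?_ hpos
  rw [hid]
  positivity

/-- Taking `m` to be the least variable in `cubic_add_node` reduces the claim to points with a zero
coordinate, where the cubic factors. -/
theorem cubic_nonneg {u v w : ℝ} (hu : 0 ≤ u) (hv : 0 ≤ v) (hw : 0 ≤ w) :
    0 ≤ cubic p q u v w := by
  have key : ∀ m u v w : ℝ, 0 ≤ m → 0 ≤ cubic p q u v w →
      0 ≤ cubic p q (m + u) (m + v) (m + w) := fun m u v w hm hc => by
    rw [cubic_add_node]
    exact add_nonneg hc (mul_nonneg hm (h.nodeForm_nonneg u v w))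
  have hr : 0 ≤ 1 - p ^ 2 * q ^ 2 := by linarith [h.pq_sq_lt]
  have hk : 0 ≤ q ^ 2 * (1 - p ^ 2) ^ 2 - p ^ 2 := by linarith [h.p_sq_le]
  have face₀ : ∀ v w : ℝ, 0 ≤ v → 0 ≤ cubic p q 0 v w := fun v w hv => by
    have : cubic p q 0 v w = p ^ 2 * v * (w - q ^ 2 * v) ^ 2 := by unfold cubic; ring
    rw [this]
    positivity
  have face₁ : ∀ u w : ℝ, 0 ≤ u → 0 ≤ w → 0 ≤ cubic p q u 0 w := fun u w hu hw => by
    have : cubic p q u 0 w = u * (p ^ 2 * q ^ 2 * u + w) *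
        (p ^ 2 * (1 - p ^ 2 * q ^ 2) * u + (q ^ 2 * (1 - p ^ 2) ^ 2 - p ^ 2) * w) := by
      unfold cubic; ring
    rw [this]
    positivity
  have face₂ : ∀ u v : ℝ, 0 ≤ u → 0 ≤ v → 0 ≤ cubic p q u v 0 := fun u v hu hv => by
    have : cubic p q u v 0 = q ^ 2 * (p ^ 2 * u - v) ^ 2 *
        ((1 - p ^ 2 * q ^ 2) * u + p ^ 2 * q ^ 2 * v) := by
      unfold cubic; ring
    rw [this]
    positivity
  rcases le_total u v with h1 | h1 <;> rcases le_total v w with h2 | h2 <;>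
    rcases le_total u w with h3 | h3
  · simpa using key u 0 (v - u) (w - u) hu (face₀ _ _ (by linarith))
  · simpa using key u 0 (v - u) (w - u) hu (face₀ _ _ (by linarith))
  · simpa using key u 0 (v - u) (w - u) hu (face₀ _ _ (by linarith))
  · simpa using key w (u - w) (v - w) 0 hw (face₂ _ _ (by linarith) (by linarith))
  · simpa using key v (u - v) 0 (w - v) hv (face₁ _ _ (by linarith) (by linarith))
  · simpa using key v (u - v) 0 (w - v) hv (face₁ _ _ (by linarith) (by linarith))
  · simpa using key w (u - w) (v - w) 0 hw (face₂ _ _ (by linarith) (by linarith))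
  · simpa using key w (u - w) (v - w) 0 hw (face₂ _ _ (by linarith) (by linarith))

end Admissible

/-! ### Positivity of `Psi` from principal minors -/

open Complex ComplexConjugate

theorem hermitianForm_two_nonneg {P R : ℝ} {e : ℂ} (hP : 0 ≤ P) (hR : 0 ≤ R)
    (he : normSq e ≤ P * R) (y z : ℂ) :
    0 ≤ P * normSq y + R * normSq z + 2 * (conj y * e * z).re := by
  rcases hP.eq_or_lt with rfl | hP
  · have : e = 0 := normSq_eq_zero.1 (le_antisymm (by simpa using he) (normSq_nonneg e))
    simp only [this, mul_zero, zero_mul, zero_re, add_zero, zero_add]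
    exact mul_nonneg hR (normSq_nonneg z)
  · refine nonneg_of_mul_nonneg_right (a := P) ?_ hP
    have hid : P * (P * normSq y + R * normSq z + 2 * (conj y * e * z).re) =
        normSq (P * y + e * z) + (P * R - normSq e) * normSq z := by
      simp only [normSq_apply, mul_re, mul_im, add_re, add_im, conj_re, conj_im, ofReal_re,
        ofReal_im]
      ring
    rw [hid]
    exact add_nonneg (normSq_nonneg _) (mul_nonneg (by linarith) (normSq_nonneg _))

/-- Completing the square in `x` leaves the Schur complement, a `2 × 2` form whose determinant is
`α` times the full determinant. If `α = 0`, the minors force the first row to vanish. -/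
theorem hermitianForm_three_nonneg {α β γ : ℝ} {c d e : ℂ} (hα : 0 ≤ α) (hβ : 0 ≤ β)
    (hγ : 0 ≤ γ) (hc : normSq c ≤ α * β) (hd : normSq d ≤ α * γ) (he : normSq e ≤ β * γ)
    (hdet : 0 ≤ α * β * γ + 2 * (c * e * conj d).re - α * normSq e - β * normSq d - γ * normSq c)
    (x y z : ℂ) :
    0 ≤ α * normSq x + β * normSq y + γ * normSq z +
      2 * ((conj x * c * y).re + (conj x * d * z).re + (conj y * e * z).re) := by
  rcases hα.eq_or_lt with rfl | hα
  · have hc0 : c = 0 := normSq_eq_zero.1 (le_antisymm (by simpa using hc) (normSq_nonneg c))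
    have hd0 : d = 0 := normSq_eq_zero.1 (le_antisymm (by simpa using hd) (normSq_nonneg d))
    have := hermitianForm_two_nonneg hβ hγ he y z
    simpa [hc0, hd0] using this
  · refine nonneg_of_mul_nonneg_right (a := α) ?_ hα
    have hs : normSq (α * e - conj c * d) ≤ (α * β - normSq c) * (α * γ - normSq d) := by
      have hid : (α * β - normSq c) * (α * γ - normSq d) - normSq (α * e - conj c * d) =
          α * (α * β * γ + 2 * (c * e * conj d).re - α * normSq e - β * normSq d
            - γ * normSq c) := by
        simp only [normSq_apply, mul_re, mul_im, sub_re, sub_im, conj_re, conj_im, ofReal_re,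
          ofReal_im]
        ring
      have := mul_nonneg hα.le hdet
      linarith
    have h2 := hermitianForm_two_nonneg (sub_nonneg.2 hc) (sub_nonneg.2 hd) hs y z
    have hid : α * (α * normSq x + β * normSq y + γ * normSq z +
        2 * ((conj x * c * y).re + (conj x * d * z).re + (conj y * e * z).re)) =
        normSq (α * x + c * y + d * z) +
          ((α * β - normSq c) * normSq y + (α * γ - normSq d) * normSq z +
            2 * (conj y * (α * e - conj c * d) * z).re) := by
      simp only [normSq_apply, mul_re, mul_im, add_re, add_im, sub_re, sub_im, conj_re, conj_im,
        ofReal_re, ofReal_im]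
      ring
    rw [hid]
    exact add_nonneg (normSq_nonneg _) h2

/-- A Hermitian `3 × 3` matrix with nonnegative principal minors is positive semidefinite. -/
theorem posSemidef_of_minors {α β γ : ℝ} {c d e : ℂ} (hα : 0 ≤ α) (hβ : 0 ≤ β)
    (hγ : 0 ≤ γ) (hc : normSq c ≤ α * β) (hd : normSq d ≤ α * γ) (he : normSq e ≤ β * γ)
    (hdet : 0 ≤ α * β * γ + 2 * (c * e * conj d).re - α * normSq e - β * normSq d
      - γ * normSq c) :
    (!![(α : ℂ), c, d; conj c, β, e; conj d, conj e, γ]).PosSemidef := by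
  refine .of_dotProduct_mulVec_nonneg ?_ fun x => ?_
  · ext i j
    fin_cases i <;> fin_cases j <;> simp
  · have h := hermitianForm_three_nonneg hα hβ hγ hc hd he hdet (x 0) (x 1) (x 2)
    rw [Complex.nonneg_iff]
    constructor
    · refine h.trans_eq ?_
      simp [dotProduct, Matrix.mulVec, Fin.sum_univ_three, normSq_apply]
      ring
    · simp [dotProduct, Matrix.mulVec, Fin.sum_univ_three]
      ring

theorem posSemidef_map_of_forall_vecMulVec {m n : Type*} [Finite m] [Fintype n]
    (Φ : Matrix n n ℂ →ₗ[ℂ] Matrix m m ℂ)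
    (h : ∀ x : n → ℂ, (Φ (Matrix.vecMulVec x (star x))).PosSemidef)
    {Z : Matrix n n ℂ} (hZ : Z.PosSemidef) : (Φ Z).PosSemidef := by
  classical
  open scoped MatrixOrder in
  obtain ⟨X, rfl⟩ := CStarAlgebra.nonneg_iff_eq_star_mul_self.mp hZ.nonneg
  have : star X * X = ∑ k, Matrix.vecMulVec (star (X k)) (star (star (X k))) := by
    ext i j
    simp [Matrix.mul_apply, Matrix.sum_apply, Matrix.vecMulVec_apply, Matrix.star_apply]
  rw [this, map_sum]
  exact Matrix.posSemidef_sum _ fun k _ => h _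

namespace Admissible

variable {p q : ℝ} (h : Admissible p q)
include h

theorem posSemidef_Psi_vecMulVec (x : Fin 3 → ℂ) :
    (Psi p q (Matrix.vecMulVec x (star x))).PosSemidef := by
  have hp := h.p_pos
  have hq := h.q_pos
  have hB : 0 ≤ 2 * p - q := by linarith [h.le_two_mul]
  have hr : 0 ≤ 1 - p ^ 2 * q ^ 2 := by linarith [h.pq_sq_lt]
  have hs : 0 < 1 - p * q := by linarith [h.pq_lt]
  have hk : 0 ≤ q * (1 - p ^ 2) - p := by linarith [h.p_le]
  have hl : 0 ≤ p + q * (1 - p ^ 2) := by linarith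
  obtain ⟨u, hu⟩ : ∃ u, u = normSq (x 0) := ⟨_, rfl⟩
  obtain ⟨v, hv⟩ : ∃ v, v = normSq (x 1) := ⟨_, rfl⟩
  obtain ⟨w, hw⟩ : ∃ w, w = normSq (x 2) := ⟨_, rfl⟩
  have hu0 : 0 ≤ u := hu ▸ normSq_nonneg _
  have hv0 : 0 ≤ v := hv ▸ normSq_nonneg _
  have hw0 : 0 ≤ w := hw ▸ normSq_nonneg _
  obtain ⟨α, hα⟩ : ∃ α, α = p ^ 2 * (p * q - 1) ^ 2 * u + q * (2 * p - q) * v := ⟨_, rfl⟩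
  obtain ⟨β, hβ⟩ : ∃ β, β = p ^ 2 * q ^ 3 * (2 * p - q) * u + q ^ 2 * (p * q - 1) ^ 2 * v
      + q * (2 * p - q) * w := ⟨_, rfl⟩
  obtain ⟨γ, hγ⟩ : ∃ γ, γ = q * (2 * p - q) * (1 - p ^ 2 * q ^ 2) * u
      + p ^ 2 * q ^ 3 * (2 * p - q) * v + p ^ 2 * (p * q - 1) ^ 2 * w := ⟨_, rfl⟩
  obtain ⟨a, ha⟩ : ∃ a, a = -p * q * (1 - q ^ 2 + p ^ 2 * q ^ 2) := ⟨_, rfl⟩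
  obtain ⟨b, hb⟩ : ∃ b, b = (p * q - 1) * (p ^ 2 + p * q - p ^ 3 * q - q ^ 2 + p ^ 2 * q ^ 2) :=
    ⟨_, rfl⟩
  have hu' : x 0 * conj (x 0) = (u : ℂ) := by rw [mul_conj, hu]
  have hv' : x 1 * conj (x 1) = (v : ℂ) := by rw [mul_conj, hv]
  have hw' : x 2 * conj (x 2) = (w : ℂ) := by rw [mul_conj, hw]
  have hM : Psi p q (Matrix.vecMulVec x (star x)) =
      !![(α : ℂ), a * (x 0 * conj (x 1)), b * (x 0 * conj (x 2));
        conj (a * (x 0 * conj (x 1))), β, a * (x 1 * conj (x 2));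
        conj (b * (x 0 * conj (x 2))), conj (a * (x 1 * conj (x 2))), γ] := by
    have hc : ∀ (c : ℝ) (z z' : ℂ), conj (c * (z * conj z')) = c * (z' * conj z) := fun c z z' => by
      rw [map_mul, map_mul, conj_ofReal, conj_conj, mul_comm (conj z)]
    rw [hc, hc, hc, hα, hβ, hγ, ha, hb]
    ext i j
    fin_cases i <;> fin_cases j <;> simp [Psi, Matrix.vecMulVec_apply, hu', hv', hw']
  have hn : ∀ (c : ℝ) (z z' : ℂ), normSq (c * (z * conj z')) = c ^ 2 * (normSq z * normSq z') :=
    fun c z z' => by simp [normSq_mul, normSq_conj, normSq_ofReal, pow_two]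
  have h01 : α * β - a ^ 2 * (u * v) =
      (1 - p * q) ^ 2 * (q * (2 * p - q)) * (q ^ 2 * (p ^ 2 * u - v) ^ 2
        + u * w * p ^ 2) + (q * (2 * p - q)) ^ 2 * v * w := by
    rw [hα, hβ, ha]; ring
  have h12 : β * γ - a ^ 2 * (v * w) =
      (1 - p * q) ^ 2 * (q * (2 * p - q)) * p ^ 2 * (q ^ 2 * v - w) ^ 2 +
      (q * (2 * p - q)) * u * (p ^ 2 * q ^ 2 * (q * (2 * p - q)) * (1 - p ^ 2 * q ^ 2) * u
        + (p ^ 4 * q ^ 4 * (q * (2 * p - q)) + q ^ 2 * (1 - p * q) ^ 2 * (1 - p ^ 2 * q ^ 2)) * v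
        + (p ^ 4 * q ^ 2 * (1 - p * q) ^ 2 + (q * (2 * p - q)) * (1 - p ^ 2 * q ^ 2)) * w) := by
    rw [hβ, hγ, ha]; ring
  -- The factor `q * (1 - p ^ 2) - p` is where the last inequality of the region enters this minor.
  have h02 : α * γ - b ^ 2 * (u * w) =
      (1 - p * q) ^ 2 * (q * (2 * p - q)) * (q * (1 - p ^ 2) - p) * (p + q * (1 - p ^ 2)) * (u * w) +
      p ^ 2 * (1 - p * q) ^ 2 * u * (q * (2 * p - q) * (1 - p ^ 2 * q ^ 2) * u
        + p ^ 2 * q ^ 3 * (2 * p - q) * v) + q * (2 * p - q) * v * γ := by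
    rw [hα, hγ, hb]; ring
  have hdet : α * β * γ + 2 * (a ^ 2 * b) * (u * v * w) - α * (a ^ 2 * (v * w))
      - β * (b ^ 2 * (u * w)) - γ * (a ^ 2 * (u * v)) =
      q ^ 2 * (1 - p * q) ^ 2 * (2 * p - q) ^ 2 * cubic p q u v w := by
    rw [hα, hβ, hγ, ha, hb]; unfold cubic; ring
  have hγ0 : 0 ≤ γ := by rw [hγ]; positivity
  rw [hM]
  refine posSemidef_of_minors (by rw [hα]; positivity) (by rw [hβ]; positivity) hγ0 ?_ ?_ ?_ ?_
  · rw [hn, ← hu, ← hv, ← sub_nonneg, h01]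
    positivity
  · rw [hn, ← hu, ← hw, ← sub_nonneg, h02]
    positivity
  · rw [hn, ← hv, ← hw, ← sub_nonneg, h12]
    positivity
  -- The phases cancel around the cycle `0 → 1 → 2 → 0`, so the triple product is real.
  · have hre : (a * (x 0 * conj (x 1)) * (a * (x 1 * conj (x 2))) *
        conj (b * (x 0 * conj (x 2)))).re = a ^ 2 * b * (u * v * w) := by
      have : a * (x 0 * conj (x 1)) * (a * (x 1 * conj (x 2))) * conj (b * (x 0 * conj (x 2))) =
          ((a ^ 2 * b * (u * v * w) : ℝ) : ℂ) := by
        simp only [hu, hv, hw, map_mul, conj_ofReal, conj_conj, ofReal_mul, ofReal_pow,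
          normSq_eq_conj_mul_self]
        ring
      rw [this, ofReal_re]
    rw [hn, hn, hn, ← hu, ← hv, ← hw, hre, ← mul_assoc 2, hdet]
    have := h.cubic_nonneg hu0 hv0 hw0
    positivity

theorem isPositive_Psi : IsPositive (Psi p q) := by
  refine ⟨fun Z => ?_, fun Z hZ => posSemidef_map_of_forall_vecMulVec _
    h.posSemidef_Psi_vecMulVec hZ⟩
  ext i j
  fin_cases i <;> fin_cases j <;> simp [Psi]

end Admissible

/-! ### Fourier coefficients on the torus -/

/-- The frequencies `-1, 0, 1, 2` are distinct modulo `4`, so the fourth roots of unity already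
separate them. -/
theorem fourier_coeff_eq_zero {c₃ c₀ c₁ c₂ : ℂ}
    (h : ∀ w : ℂ, w * conj w = 1 → c₃ * conj w + c₀ + c₁ * w + c₂ * w ^ 2 = 0) :
    c₃ = 0 ∧ c₀ = 0 ∧ c₁ = 0 ∧ c₂ = 0 := by
  have h1 := h 1 (by simp)
  have h2 := h (-1) (by simp)
  have h3 := h I (by simp)
  have h4 := h (-I) (by simp)
  simp only [map_one, map_neg, conj_I, neg_sq, I_sq, one_pow] at h1 h2 h3 h4
  have h5 : c₁ - c₃ = 0 := by
    have : I * (c₁ - c₃) = 0 := by linear_combination (h3 - h4) / 2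
    exact (mul_eq_zero.1 this).resolve_left I_ne_zero
  refine ⟨?_, ?_, ?_, ?_⟩
  · linear_combination (h1 - h2) / 4 - h5 / 2
  · linear_combination (h1 + h2 + h3 + h4) / 4
  · linear_combination (h1 - h2) / 4 + h5 / 2
  · linear_combination (h1 + h2 - h3 - h4) / 4

/-- Points of the torus of diagonal unitaries. -/
def IsPhase (D : Fin 3 → ℂ) : Prop := ∀ m, D m * conj (D m) = 1

/-- The two conclusions are the weights `2 e_j - e_l` and `e_m`. In the second, `S m m m` occurs in
both sums and is subtracted once. -/
theorem weight_coeff_eq_zero (S : Fin 3 → Fin 3 → Fin 3 → ℂ)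
    (h : ∀ D, IsPhase D → ∑ j, ∑ k, ∑ l, S j k l * (D j * D k * conj (D l)) = 0) :
    (∀ j l, j ≠ l → S j j l = 0) ∧
      ∀ m, ∑ k, S m k k + ∑ j, S j m j - S m m m = 0 := by
  have h1 : ∀ z : ℂ, z * conj z = 1 → _ := fun z hz =>
    fourier_coeff_eq_zero
      (c₃ := S 0 0 1 + (S 0 2 1 + S 2 0 1) * z + S 2 2 1 * z ^ 2)
      (c₀ := S 0 0 2 * conj z + (S 0 0 0 + S 0 2 2 + S 2 0 2 + S 1 0 1 + S 0 1 1)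
        + (S 0 2 0 + S 2 0 0 + S 2 2 2 + S 1 2 1 + S 2 1 1) * z + S 2 2 0 * z ^ 2)
      (c₁ := (S 0 1 2 + S 1 0 2) * conj z + (S 1 1 1 + S 0 1 0 + S 1 0 0 + S 1 2 2 + S 2 1 2)
        + (S 1 2 0 + S 2 1 0) * z)
      (c₂ := S 1 1 0 + S 1 1 2 * conj z)
      (fun w hw => by
        -- Every monomial has total degree `1` in the torus, so fixing the first phase loses no
        -- information.
        have := h ![1, w, z] (fun m => by fin_cases m <;> simp [hw, hz])
        simp only [Fin.sum_univ_three, Matrix.cons_val_zero, Matrix.cons_val_one,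
          Matrix.cons_val, map_one] at this
        linear_combination this
          - (S 1 0 1 + S 0 1 1 + (S 1 2 1 + S 2 1 1) * z + S 1 1 1 * w) * hw
          - (S 0 2 2 + S 2 0 2 + S 2 2 2 * z + (S 1 2 2 + S 2 1 2) * w) * hz)
  obtain ⟨a3, a0, a1, a2⟩ := fourier_coeff_eq_zero (c₃ := 0)
    (c₀ := S 0 0 1) (c₁ := S 0 2 1 + S 2 0 1) (c₂ := S 2 2 1) (fun z hz => by
    linear_combination (h1 z hz).1)
  obtain ⟨b3, b0, b1, b2⟩ := fourier_coeff_eq_zero (fun z hz => (h1 z hz).2.1)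
  obtain ⟨c3, c0, c1, c2⟩ := fourier_coeff_eq_zero (c₃ := S 0 1 2 + S 1 0 2)
    (c₀ := S 1 1 1 + S 0 1 0 + S 1 0 0 + S 1 2 2 + S 2 1 2) (c₁ := S 1 2 0 + S 2 1 0) (c₂ := 0) (fun z hz => by
    linear_combination (h1 z hz).2.2.1)
  obtain ⟨d3, d0, d1, d2⟩ := fourier_coeff_eq_zero (c₃ := S 1 1 2)
    (c₀ := S 1 1 0) (c₁ := 0) (c₂ := 0) (fun z hz => by
    linear_combination (h1 z hz).2.2.2)
  constructor
  · intro j l hjl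
    fin_cases j <;> fin_cases l <;> first | exact absurd rfl hjl | assumption
  · intro m
    fin_cases m <;> simp only [Fin.sum_univ_three, Fin.zero_eta, Fin.mk_one, Fin.reduceFinMk]
    · linear_combination b0
    · linear_combination c0
    · linear_combination b1

/-! ### Zeros of the biquadratic form -/

/-- The coefficients of a linear map of matrices: `Φ(E_kl)_ij`. -/
def coeff (Φ : Matrix (Fin 3) (Fin 3) ℂ →ₗ[ℂ] Matrix (Fin 3) (Fin 3) ℂ) (i j k l : Fin 3) : ℂ :=
  Φ (Matrix.single k l 1) i j

variable {Φ Φ₁ Φ₂ : Matrix (Fin 3) (Fin 3) ℂ →ₗ[ℂ] Matrix (Fin 3) (Fin 3) ℂ}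

theorem apply_eq_sum_coeff (Z : Matrix (Fin 3) (Fin 3) ℂ) (i j : Fin 3) :
    Φ Z i j = ∑ k, ∑ l, coeff Φ i j k l * Z k l := by
  conv_lhs => rw [Matrix.matrix_eq_sum_single Z]
  simp only [map_sum, Matrix.sum_apply, coeff]
  refine Finset.sum_congr rfl fun k _ => Finset.sum_congr rfl fun l _ => ?_
  have : Matrix.single k l (Z k l) = Z k l • Matrix.single k l 1 := by simp
  rw [this, map_smul, Matrix.smul_apply, smul_eq_mul, mul_comm]

theorem IsPositive.conj_coeff (hΦ : IsPositive Φ) (i j k l : Fin 3) :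
    conj (coeff Φ i j k l) = coeff Φ j i l k := by
  have := congrFun (congrFun (hΦ.1 (Matrix.single k l 1)) j) i
  rw [Matrix.conjTranspose_single, star_one] at this
  exact this.symm

/-- The biquadratic form `y† Φ(x x†) y`. -/
def form (Φ : Matrix (Fin 3) (Fin 3) ℂ →ₗ[ℂ] Matrix (Fin 3) (Fin 3) ℂ) (x y : Fin 3 → ℂ) : ℂ :=
  star y ⬝ᵥ (Φ (Matrix.vecMulVec x (star x)) *ᵥ y)

theorem IsPositive.form_nonneg (hΦ : IsPositive Φ) (x y : Fin 3 → ℂ) : 0 ≤ form Φ x y :=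
  (hΦ.2 _ (Matrix.posSemidef_vecMulVec_self_star x)).dotProduct_mulVec_nonneg y

theorem form_add (x y : Fin 3 → ℂ) : form (Φ₁ + Φ₂) x y = form Φ₁ x y + form Φ₂ x y := by
  simp [form, Matrix.add_mulVec, dotProduct_add]

/-- A zero of a positive semidefinite form lies in the kernel, so `Φ(x x†) y = 0`; this is its
`i`-th entry. -/
theorem IsPositive.sum_left_eq_zero (hΦ : IsPositive Φ) {x y : Fin 3 → ℂ} (h : form Φ x y = 0)
    (i : Fin 3) : ∑ j, ∑ k, ∑ l, coeff Φ i j k l * (y j * x k * conj (x l)) = 0 := by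
  have := congrFun (((hΦ.2 _ (Matrix.posSemidef_vecMulVec_self_star x)).dotProduct_mulVec_zero_iff
    y).1 h) i
  simp only [Matrix.mulVec, dotProduct, apply_eq_sum_coeff (Φ := Φ), Matrix.vecMulVec_apply,
    Pi.zero_apply, Finset.sum_mul, Pi.star_apply, RCLike.star_def] at this
  rw [← this]
  refine Finset.sum_congr rfl fun j _ => Finset.sum_congr rfl fun k _ =>
    Finset.sum_congr rfl fun l _ => ?_
  ring

theorem form_eq_sum (x y : Fin 3 → ℂ) : form Φ x y =
    ∑ i, ∑ j, ∑ k, ∑ l, coeff Φ i j k l * (conj (y i) * y j * x k * conj (x l)) := by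
  simp only [form, Matrix.mulVec, dotProduct, apply_eq_sum_coeff (Φ := Φ), Matrix.vecMulVec_apply,
    Finset.sum_mul, Finset.mul_sum, Pi.star_apply, RCLike.star_def]
  refine Finset.sum_congr rfl fun i _ => Finset.sum_congr rfl fun j _ =>
    Finset.sum_congr rfl fun k _ => Finset.sum_congr rfl fun l _ => ?_
  ring

/-- The same argument with `y` fixed: the form is then a positive semidefinite form in `x`, with
matrix `N`. -/
theorem IsPositive.sum_right_eq_zero (hΦ : IsPositive Φ) {x y : Fin 3 → ℂ} (h : form Φ x y = 0)
    (l : Fin 3) : ∑ j, ∑ k, ∑ i, coeff Φ i j k l * (y j * x k * conj (y i)) = 0 := by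
  let N : Matrix (Fin 3) (Fin 3) ℂ :=
    Matrix.of fun l k => ∑ i, ∑ j, coeff Φ i j k l * (conj (y i) * y j)
  have hN : ∀ z : Fin 3 → ℂ, star z ⬝ᵥ (N *ᵥ z) = form Φ z y := fun z => by
    rw [form_eq_sum]
    simp only [N, Matrix.mulVec, dotProduct, Matrix.of_apply,
      Pi.star_apply, RCLike.star_def, Fin.sum_univ_three]
    ring
  have hH : N.IsHermitian := by
    ext k l
    simp only [N, Matrix.conjTranspose_apply, Matrix.of_apply, RCLike.star_def, map_sum, map_mul,
      hΦ.conj_coeff, conj_conj]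
    rw [Finset.sum_comm]
    refine Finset.sum_congr rfl fun i _ => Finset.sum_congr rfl fun j _ => ?_
    ring
  have hP : N.PosSemidef := .of_dotProduct_mulVec_nonneg hH fun z => hN z ▸ hΦ.form_nonneg z y
  have := congrFun ((hP.dotProduct_mulVec_zero_iff x).1 ((hN x).trans h)) l
  simp only [N, Matrix.mulVec, dotProduct, Matrix.of_apply, Pi.zero_apply,
    Fin.sum_univ_three] at this
  simp only [Fin.sum_univ_three]
  linear_combination this

/-- `(x, y)` and all its translates by diagonal unitaries are zeros of the form of `Φ`. -/
def HasTorusZero (Φ : Matrix (Fin 3) (Fin 3) ℂ →ₗ[ℂ] Matrix (Fin 3) (Fin 3) ℂ)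
    (x y : Fin 3 → ℝ) : Prop :=
  ∀ D, IsPhase D → form Φ (fun m => D m * x m) (fun m => D m * y m) = 0

theorem HasTorusZero.of_add {x y : Fin 3 → ℝ} (h : HasTorusZero (Φ₁ + Φ₂) x y)
    (h₁ : IsPositive Φ₁) (h₂ : IsPositive Φ₂) : HasTorusZero Φ₁ x y := fun D hD => by
  have := h D hD
  rw [form_add] at this
  exact ((add_eq_zero_iff_of_nonneg (h₁.form_nonneg _ _) (h₂.form_nonneg _ _)).1 this).1

section

variable {x y : Fin 3 → ℝ} (h : HasTorusZero Φ x y) (hΦ : IsPositive Φ)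
include h hΦ

theorem HasTorusZero.left (i : Fin 3) :
    (∀ j l, j ≠ l → coeff Φ i j j l * (y j * x j * x l) = 0) ∧
      ∀ m, ∑ k, coeff Φ i m k k * (y m * x k * x k) + ∑ j, coeff Φ i j m j * (y j * x m * x j)
        - coeff Φ i m m m * (y m * x m * x m) = 0 :=
  weight_coeff_eq_zero (fun j k l => coeff Φ i j k l * (y j * x k * x l)) fun D hD => by
    rw [← hΦ.sum_left_eq_zero (h D hD) i]
    refine Finset.sum_congr rfl fun j _ => Finset.sum_congr rfl fun k _ =>
      Finset.sum_congr rfl fun l _ => ?_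
    rw [map_mul, conj_ofReal]
    ring

theorem HasTorusZero.right (l : Fin 3) :
    (∀ j i, j ≠ i → coeff Φ i j j l * (y j * x j * y i) = 0) ∧
      ∀ m, ∑ k, coeff Φ k m k l * (y m * x k * y k) + ∑ j, coeff Φ j j m l * (y j * x m * y j)
        - coeff Φ m m m l * (y m * x m * y m) = 0 :=
  weight_coeff_eq_zero (fun j k i => coeff Φ i j k l * (y j * x k * y i)) fun D hD => by
    rw [← hΦ.sum_right_eq_zero (h D hD) l]
    refine Finset.sum_congr rfl fun j _ => Finset.sum_congr rfl fun k _ =>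
      Finset.sum_congr rfl fun i _ => ?_
    rw [map_mul, conj_ofReal]
    ring

end

/-- `Psi` commutes with conjugation by diagonal unitaries, so one real zero yields a whole orbit. -/
theorem form_Psi (p q : ℝ) (x y : Fin 3 → ℝ) {D : Fin 3 → ℂ} (hD : IsPhase D) :
    form (Psi p q) (fun m => D m * x m) (fun m => D m * y m) = form (Psi p q) (fun m => x m)
      (fun m => y m) := by
  have hD0 : ∀ m, D m ≠ 0 := fun m hm => by simpa [hm] using hD m
  have hc : ∀ m, conj (D m) = (D m)⁻¹ := fun m => eq_inv_of_mul_eq_one_right (hD m)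
  have h0 := hD0 0
  have h1 := hD0 1
  have h2 := hD0 2
  simp only [form, Psi, LinearMap.coe_mk, AddHom.coe_mk, dotProduct, Matrix.mulVec,
    Fin.sum_univ_three, Matrix.of_apply, Matrix.cons_val, Matrix.vecMulVec_apply, Pi.star_apply,
    RCLike.star_def, map_mul, conj_ofReal, hc]
  field_simp

theorem hasTorusZero_Psi {p q : ℝ} {x y : Fin 3 → ℝ}
    (h : Psi p q (Matrix.vecMulVec (fun m => (x m : ℂ)) (fun m => (x m : ℂ))) *ᵥ
      (fun m => (y m : ℂ)) = 0) : HasTorusZero (Psi p q) x y := fun D hD => by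
  have hx : star (fun m => (x m : ℂ)) = fun m => (x m : ℂ) := by ext; simp
  rw [form_Psi p q x y hD, form, hx, h, dotProduct_zero]

theorem hasTorusZero_Psi_corner (p q : ℝ) : HasTorusZero (Psi p q) ![0, 0, 1] ![1, 0, 0] :=
  hasTorusZero_Psi <| by
    ext i
    fin_cases i <;>
      simp [Psi, Matrix.mulVec, dotProduct, Fin.sum_univ_three, Matrix.vecMulVec_apply]

theorem hasTorusZero_Psi_left (p q : ℝ) : HasTorusZero (Psi p q) ![1, p, 0] ![q, 1, 0] :=
  hasTorusZero_Psi <| by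
    ext i
    fin_cases i <;>
      simp [Psi, Matrix.mulVec, dotProduct, Fin.sum_univ_three, Matrix.vecMulVec_apply] <;> ring

theorem hasTorusZero_Psi_right (p q : ℝ) : HasTorusZero (Psi p q) ![0, 1, q] ![0, p, 1] :=
  hasTorusZero_Psi <| by
    ext i
    fin_cases i <;>
      simp [Psi, Matrix.mulVec, dotProduct, Fin.sum_univ_three, Matrix.vecMulVec_apply] <;> ring

theorem hasTorusZero_Psi_one (p q : ℝ) : HasTorusZero (Psi p q) ![1, 1, 1] ![1, 1, 1] :=
  hasTorusZero_Psi <| by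
    ext i
    fin_cases i <;>
      simp [Psi, Matrix.mulVec, dotProduct, Fin.sum_univ_three, Matrix.vecMulVec_apply] <;> ring

theorem sum_fin_three_of_distinct {a b c : Fin 3} (hab : a ≠ b) (hac : a ≠ c) (hbc : b ≠ c)
    (f : Fin 3 → ℂ) : ∑ i, f i = f a + f b + f c := by
  have : (Finset.univ : Finset (Fin 3)) = {a, b, c} := by
    revert a b c
    decide
  rw [this, Finset.sum_insert (by simp [hab, hac]), Finset.sum_pair hbc, add_assoc]

/-! ### Vanishing of the coefficients that the torus does not fix -/

/-- The conditions that a positive map inherits from the zeros of `Ψ_{p,q}`. -/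
structure HasPsiZeros (p q : ℝ) (Φ : Matrix (Fin 3) (Fin 3) ℂ →ₗ[ℂ] Matrix (Fin 3) (Fin 3) ℂ) :
    Prop where
  pos : IsPositive Φ
  corner : HasTorusZero Φ ![0, 0, 1] ![1, 0, 0]
  left : HasTorusZero Φ ![1, p, 0] ![q, 1, 0]
  right : HasTorusZero Φ ![0, 1, q] ![0, p, 1]
  one : HasTorusZero Φ ![1, 1, 1] ![1, 1, 1]

theorem HasPsiZeros.of_add {p q : ℝ}
    {Φ₁ Φ₂ : Matrix (Fin 3) (Fin 3) ℂ →ₗ[ℂ] Matrix (Fin 3) (Fin 3) ℂ} (h₁ : IsPositive Φ₁)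
    (h₂ : IsPositive Φ₂) (h : Psi p q = Φ₁ + Φ₂) : HasPsiZeros p q Φ₁ where
  pos := h₁
  corner := (h ▸ hasTorusZero_Psi_corner p q).of_add h₁ h₂
  left := (h ▸ hasTorusZero_Psi_left p q).of_add h₁ h₂
  right := (h ▸ hasTorusZero_Psi_right p q).of_add h₁ h₂
  one := (h ▸ hasTorusZero_Psi_one p q).of_add h₁ h₂

theorem vecOne_apply (m : Fin 3) : (![1, 1, 1] : Fin 3 → ℝ) m = 1 := by
  fin_cases m <;> rfl

namespace HasPsiZeros

variable {p q : ℝ} (h : HasPsiZeros p q Φ)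
include h

theorem coeff_mid_eq_zero {i j l : Fin 3} (hne : i ≠ j ∨ j ≠ l) : coeff Φ i j j l = 0 := by
  rcases hne with hne | hne
  · simpa [vecOne_apply] using (h.one.right h.pos l).1 j i hne.symm
  · simpa [vecOne_apply] using (h.one.left h.pos i).1 j l hne

theorem coeff_outer_eq_zero {i j k : Fin 3} (hne : i ≠ j ∨ i ≠ k) : coeff Φ i j k i = 0 := by
  have := h.coeff_mid_eq_zero (i := j) (j := i) (l := k) (hne.imp Ne.symm id)
  rw [← h.pos.conj_coeff j i i k, this, map_zero]

/-- In the weight `e_a` equation of row `b`, the terms with a repeated inner or outer index are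
already zero; only two unknowns remain. -/
theorem left_pair {x y : Fin 3 → ℝ} (hz : HasTorusZero Φ x y) {a b c : Fin 3} (hab : a ≠ b)
    (hac : a ≠ c) (hbc : b ≠ c) :
    coeff Φ b a c c * (y a * x c * x c) + coeff Φ b c a c * (y c * x a * x c) = 0 := by
  have := (hz.left h.pos b).2 a
  rw [sum_fin_three_of_distinct hab hac hbc, sum_fin_three_of_distinct hab hac hbc,
    h.coeff_mid_eq_zero (Or.inl hab.symm), h.coeff_outer_eq_zero (Or.inl hab.symm),
    h.coeff_outer_eq_zero (Or.inr hab.symm)] at this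
  linear_combination this

theorem right_pair {x y : Fin 3 → ℝ} (hz : HasTorusZero Φ x y) {a b c : Fin 3} (hab : a ≠ b)
    (hac : a ≠ c) (hbc : b ≠ c) :
    coeff Φ c a c b * (y a * x c * y c) + coeff Φ c c a b * (y c * x a * y c) = 0 := by
  have := (hz.right h.pos b).2 a
  rw [sum_fin_three_of_distinct hab hac hbc, sum_fin_three_of_distinct hab hac hbc,
    h.coeff_mid_eq_zero (Or.inr hab), h.coeff_outer_eq_zero (Or.inl hab.symm),
    h.coeff_outer_eq_zero (Or.inr hab.symm)] at this
  linear_combination this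

/-- The all-ones zero makes the two unknowns of each pair opposite; a zero with `y a * x c ≠ y c * x
a` gives an independent equation. -/
theorem pair_eq_zero {x y : Fin 3 → ℝ} (hz : HasTorusZero Φ x y) {a b c : Fin 3} (hab : a ≠ b)
    (hac : a ≠ c) (hbc : b ≠ c) (hx : x c ≠ 0) (hy : y c ≠ 0) (hxy : y a * x c ≠ y c * x a) :
    coeff Φ b a c c = 0 ∧ coeff Φ b c a c = 0 ∧ coeff Φ c a c b = 0 ∧ coeff Φ c c a b = 0 := by
  have h1 := h.left_pair hz hab hac hbc
  have h2 := h.right_pair hz hab hac hbc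
  have h3 := h.left_pair h.one hab hac hbc
  have h4 := h.right_pair h.one hab hac hbc
  simp only [vecOne_apply, ofReal_one, mul_one] at h3 h4
  have hx' : (x c : ℂ) ≠ 0 := by exact_mod_cast hx
  have hy' : (y c : ℂ) ≠ 0 := by exact_mod_cast hy
  have hxy' : (y a * x c - y c * x a : ℂ) ≠ 0 := by
    rw [sub_ne_zero]
    exact_mod_cast hxy
  have h5 : coeff Φ b a c c = 0 := by
    refine (mul_eq_zero.1 ?_).resolve_right (mul_ne_zero hx' hxy')
    linear_combination h1 - y c * x a * x c * h3
  have h6 : coeff Φ c a c b = 0 := by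
    refine (mul_eq_zero.1 ?_).resolve_right (mul_ne_zero hy' hxy')
    linear_combination h2 - y c * x a * y c * h4
  exact ⟨h5, by linear_combination h3 - h5, h6, by linear_combination h4 - h6⟩

/-- The zeros `left` and `right` settle the pairs `{0, 1}` and `{1, 2}`, since `p * q ≠ 1`. The pair
`{0, 2}` needs the corner zero, which gives only half of the equations, and conjugates of
coefficients already known to vanish. -/
theorem triple_eq_zero (hp : 0 < p) (hq : 0 < q) (hpq : p * q < 1) {a b c : Fin 3} (hab : a ≠ b)
    (hac : a ≠ c) (hbc : b ≠ c) :
    coeff Φ b a c c = 0 ∧ coeff Φ b c a c = 0 ∧ coeff Φ c a c b = 0 ∧ coeff Φ c c a b = 0 := by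
  have h012 := h.pair_eq_zero h.left (a := 0) (b := 2) (c := 1) (by decide) (by decide) (by decide)
    (by simpa using hp.ne') (by simp) (by simpa [mul_comm] using hpq.ne)
  have h102 := h.pair_eq_zero h.left (a := 1) (b := 2) (c := 0) (by decide) (by decide) (by decide)
    (by simp) (by simpa using hq.ne') (by simpa [mul_comm] using hpq.ne')
  have h120 := h.pair_eq_zero h.right (a := 1) (b := 0) (c := 2) (by decide) (by decide) (by decide)
    (by simpa using hq.ne') (by simp) (by simpa [mul_comm] using hpq.ne)
  have h210 := h.pair_eq_zero h.right (a := 2) (b := 0) (c := 1) (by decide) (by decide) (by decide)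
    (by simp) (by simpa using hp.ne') (by simpa [mul_comm] using hpq.ne')
  have l02 := h.left_pair h.one (a := 0) (b := 1) (c := 2) (by decide) (by decide) (by decide)
  have l20 := h.left_pair h.one (a := 2) (b := 1) (c := 0) (by decide) (by decide) (by decide)
  have r02 := h.right_pair h.one (a := 0) (b := 1) (c := 2) (by decide) (by decide) (by decide)
  have r20 := h.right_pair h.one (a := 2) (b := 1) (c := 0) (by decide) (by decide) (by decide)
  have z02 := h.left_pair h.corner (a := 0) (b := 1) (c := 2) (by decide) (by decide) (by decide)
  have z20 := h.right_pair h.corner (a := 2) (b := 1) (c := 0) (by decide) (by decide) (by decide)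
  have c1 := h.pos.conj_coeff 0 2 1 2
  have c2 := h.pos.conj_coeff 0 1 0 2
  rw [h120.2.1, map_zero] at c1
  rw [h102.2.2.1, map_zero] at c2
  simp only [vecOne_apply, ofReal_one, mul_one] at l02 l20 r02 r20
  simp at z02 z20
  rw [z02, zero_add] at l02
  rw [z20, add_zero] at r20
  rw [← c2, add_zero] at l20
  rw [← c1, zero_add] at r02
  fin_cases a <;> fin_cases b <;> fin_cases c <;>
    first
    | exact absurd rfl hab
    | exact absurd rfl hac
    | exact absurd rfl hbc
    | assumption
    | exact ⟨z02, l02, c1.symm, r02⟩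
    | exact ⟨l20, c2.symm, r20, z20⟩

theorem coeff_eq_zero (hp : 0 < p) (hq : 0 < q) (hpq : p * q < 1) {i j k l : Fin 3}
    (h1 : ¬ (i = j ∧ k = l)) (h2 : ¬ (i = k ∧ j = l)) : coeff Φ i j k l = 0 := by
  by_cases hjk : j = k
  · subst hjk
    exact h.coeff_mid_eq_zero (by tauto)
  by_cases hil : i = l
  · subst hil
    exact h.coeff_outer_eq_zero (by tauto)
  -- Four indices take three values, and the coincidences `j = k` and `i = l` have been excluded.
  have : i = j ∨ i = k ∨ j = l ∨ k = l := by
    clear h h1 h2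
    revert i j k l
    decide
  rcases this with rfl | rfl | rfl | rfl
  · exact (h.triple_eq_zero hp hq hpq (a := k) (b := l) (c := i) (by tauto) (by tauto)
      (by tauto)).2.2.2
  · exact (h.triple_eq_zero hp hq hpq (a := j) (b := l) (c := i) (by tauto) (by tauto)
      (by tauto)).2.2.1
  · exact (h.triple_eq_zero hp hq hpq (a := k) (b := i) (c := j) (by tauto) (by tauto)
      (by tauto)).2.1
  · exact (h.triple_eq_zero hp hq hpq (a := j) (b := i) (c := k) (by tauto) (by tauto)
      (by tauto)).1

end HasPsiZeros

/-! ### The remaining linear system and extremality -/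

/-- The linear system that the zeros impose on the coefficients fixed by the torus has a
one-dimensional solution space. -/
theorem exists_eq_mul_of_system {p q d₀₀ d₀₁ d₁₀ d₁₁ d₁₂ d₂₀ d₂₁ d₂₂ x y w : ℂ} (hp : p ≠ 0)
    (hq : q ≠ 0) (hr : 1 - p ^ 2 * q ^ 2 ≠ 0) (ht : 1 - q ^ 2 + p ^ 2 * q ^ 2 ≠ 0)
    (e₁ : q * (d₀₀ + p ^ 2 * d₀₁) + p * x = 0) (e₂ : d₁₀ + p ^ 2 * d₁₁ + p * q * x = 0)
    (e₃ : q ^ 2 * d₀₀ + d₁₀ + p * q * x = 0) (e₄ : p * (q ^ 2 * d₀₁ + d₁₁) + q * x = 0)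
    (f₁ : p * (d₁₁ + q ^ 2 * d₁₂) + q * y = 0) (f₂ : d₂₁ + q ^ 2 * d₂₂ + p * q * y = 0)
    (f₃ : p ^ 2 * d₁₁ + d₂₁ + p * q * y = 0)
    (g₀ : d₀₀ + d₀₁ + x + w = 0) (g₁ : d₁₀ + d₁₁ + d₁₂ + x + y = 0)
    (g₂ : d₂₀ + d₂₁ + d₂₂ + w + y = 0) (k₁ : d₀₁ + d₁₁ + d₂₁ + x + y = 0) :
    ∃ c : ℂ, d₀₀ = c * (p ^ 2 * (p * q - 1) ^ 2) ∧ d₀₁ = c * (q * (2 * p - q)) ∧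
      d₁₀ = c * (p ^ 2 * q ^ 3 * (2 * p - q)) ∧ d₁₁ = c * (q ^ 2 * (p * q - 1) ^ 2) ∧
      d₁₂ = c * (q * (2 * p - q)) ∧ d₂₀ = c * (q * (2 * p - q) * (1 - p ^ 2 * q ^ 2)) ∧
      d₂₁ = c * (p ^ 2 * q ^ 3 * (2 * p - q)) ∧ d₂₂ = c * (p ^ 2 * (p * q - 1) ^ 2) ∧
      x = c * (-p * q * (1 - q ^ 2 + p ^ 2 * q ^ 2)) ∧
      y = c * (-p * q * (1 - q ^ 2 + p ^ 2 * q ^ 2)) ∧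
      w = c * ((p * q - 1) * (p ^ 2 + p * q - p ^ 3 * q - q ^ 2 + p ^ 2 * q ^ 2)) := by
  have h10 : d₁₀ = p ^ 2 * q ^ 2 * d₀₁ := by linear_combination e₂ - p * e₄
  have h21 : d₂₁ = p ^ 2 * q ^ 2 * d₁₂ := by linear_combination f₃ - p * f₁
  have hd : d₁₂ = d₀₁ := by
    refine mul_left_cancel₀ hr ?_
    linear_combination g₁ - k₁ - h10 + h21
  subst hd
  have hy : y = x := mul_left_cancel₀ hq (by linear_combination f₁ - e₄)
  subst hy
  -- The common off-diagonal unknown fixes the scale; every other unknown is then determined by it.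
  obtain ⟨c, hc⟩ : ∃ c, y = c * (-p * q * (1 - q ^ 2 + p ^ 2 * q ^ 2)) :=
    ⟨y / (-p * q * (1 - q ^ 2 + p ^ 2 * q ^ 2)), by field_simp⟩
  have h01 : d₁₂ = c * (q * (2 * p - q)) := by
    refine mul_left_cancel₀ (mul_ne_zero hp ht) ?_
    linear_combination p * g₁ - p * h10 - e₄ - (2 * p - q) * hc
  have h11 : d₁₁ = c * (q ^ 2 * (p * q - 1) ^ 2) := by
    refine mul_left_cancel₀ hp ?_
    linear_combination e₄ - q * hc - p * q ^ 2 * h01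
  have h00 : d₀₀ = c * (p ^ 2 * (p * q - 1) ^ 2) := by
    refine mul_left_cancel₀ hq ?_
    linear_combination e₁ - p * hc - q * p ^ 2 * h01
  have h21' : d₂₁ = c * (p ^ 2 * q ^ 3 * (2 * p - q)) := by
    linear_combination h21 + p ^ 2 * q ^ 2 * h01
  have h22 : d₂₂ = c * (p ^ 2 * (p * q - 1) ^ 2) := by
    refine mul_left_cancel₀ (pow_ne_zero 2 hq) ?_
    linear_combination f₂ - h21' - p * q * hc
  have hw : w = c * ((p * q - 1) * (p ^ 2 + p * q - p ^ 3 * q - q ^ 2 + p ^ 2 * q ^ 2)) := by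
    linear_combination g₀ - h00 - h01 - hc
  refine ⟨c, h00, h01, ?_, h11, h01, ?_, h21', h22, hc, hc, hw⟩
  · linear_combination h10 + p ^ 2 * q ^ 2 * h01
  · linear_combination g₂ - h21' - h22 - hw - hc

theorem coeff_Psi_eq_zero {p q : ℝ} {i j k l : Fin 3} (h1 : ¬ (i = j ∧ k = l))
    (h2 : ¬ (i = k ∧ j = l)) : coeff (Psi p q) i j k l = 0 := by
  fin_cases i <;> fin_cases j <;> fin_cases k <;> fin_cases l <;>
    simp [coeff, Psi] at h1 h2 ⊢

theorem coeff_Psi_diag (p q : ℝ) (i k : Fin 3) : coeff (Psi p q) i i k k =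
    !![(p ^ 2 * (p * q - 1) ^ 2 : ℂ), q * (2 * p - q), 0;
      p ^ 2 * q ^ 3 * (2 * p - q), q ^ 2 * (p * q - 1) ^ 2, q * (2 * p - q);
      q * (2 * p - q) * (1 - p ^ 2 * q ^ 2), p ^ 2 * q ^ 3 * (2 * p - q),
      p ^ 2 * (p * q - 1) ^ 2] i k := by
  fin_cases i <;> fin_cases k <;> simp [coeff, Psi]

theorem coeff_Psi_offDiag (p q : ℝ) {i j : Fin 3} (h : i ≠ j) : coeff (Psi p q) i j i j =
    !![(0 : ℂ), -p * q * (1 - q ^ 2 + p ^ 2 * q ^ 2),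
        (p * q - 1) * (p ^ 2 + p * q - p ^ 3 * q - q ^ 2 + p ^ 2 * q ^ 2);
      -p * q * (1 - q ^ 2 + p ^ 2 * q ^ 2), 0, -p * q * (1 - q ^ 2 + p ^ 2 * q ^ 2);
      (p * q - 1) * (p ^ 2 + p * q - p ^ 3 * q - q ^ 2 + p ^ 2 * q ^ 2),
      -p * q * (1 - q ^ 2 + p ^ 2 * q ^ 2), 0] i j := by
  fin_cases i <;> fin_cases j <;> simp [coeff, Psi] at h ⊢

theorem HasPsiZeros.exists_eq_smul {p q : ℝ} (h : HasPsiZeros p q Φ) (hp : 0 < p) (hq : 0 < q)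
    (hpq : p * q < 1) (hB : q ≤ 2 * p) : ∃ c : ℝ, 0 ≤ c ∧ Φ = (c : ℂ) • Psi p q := by
  have hreal : ∀ i k, conj (coeff Φ i i k k) = coeff Φ i i k k := fun i k => h.pos.conj_coeff _ _ _ _
  have hsymm : ∀ i j, conj (coeff Φ i j i j) = coeff Φ j i j i := fun i j => h.pos.conj_coeff _ _ _ _
  have hp' : (p : ℂ) ≠ 0 := by exact_mod_cast hp.ne'
  have hq' : (q : ℂ) ≠ 0 := by exact_mod_cast hq.ne'
  have hr : (1 - p ^ 2 * q ^ 2 : ℂ) ≠ 0 := by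
    have : 1 - p ^ 2 * q ^ 2 ≠ 0 := by nlinarith [mul_pos hp hq]
    exact_mod_cast this
  have ht : (1 - q ^ 2 + p ^ 2 * q ^ 2 : ℂ) ≠ 0 := by
    have : 1 - q ^ 2 + p ^ 2 * q ^ 2 ≠ 0 := by
      have : 0 < (1 - p * q) ^ 2 + q * (2 * p - q) := by
        have : 0 < (1 - p * q) ^ 2 := by
          have : 0 < 1 - p * q := by linarith
          positivity
        have : 0 ≤ q * (2 * p - q) := mul_nonneg hq.le (by linarith)
        linarith
      nlinarith
    exact_mod_cast this
  have c02 := (h.corner.left h.pos 0).2 0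
  have l0 := (h.left.left h.pos 0).2 0
  have l1 := (h.left.left h.pos 1).2 1
  have l0' := (h.left.right h.pos 0).2 0
  have l1' := (h.left.right h.pos 1).2 1
  have r1 := (h.right.left h.pos 1).2 1
  have r2 := (h.right.left h.pos 2).2 2
  have r1' := (h.right.right h.pos 1).2 1
  have o0 := (h.one.left h.pos 0).2 0
  have o1 := (h.one.left h.pos 1).2 1
  have o2 := (h.one.left h.pos 2).2 2
  have o1' := (h.one.right h.pos 1).2 1
  simp only [Fin.sum_univ_three, Matrix.cons_val, ofReal_one, ofReal_zero, mul_one, mul_zero,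
    add_zero, zero_add, one_mul, zero_mul, sub_zero]
    at c02 l0 l1 l0' l1' r1 r2 r1' o0 o1 o2 o1'
  -- The diagonal coefficients are real, and the zeros express the off-diagonal ones through them
  -- with real factors. Hence these are real and symmetric.
  have s01 : coeff Φ 1 0 1 0 = coeff Φ 0 1 0 1 := by
    have hx : coeff Φ 0 1 0 1 = -(q / p) * (coeff Φ 0 0 0 0 + p ^ 2 * coeff Φ 0 0 1 1) := by
      field_simp
      linear_combination l0
    rw [← hsymm 0 1, hx]
    simp only [map_mul, map_neg, map_add, map_div₀, map_pow, conj_ofReal, hreal]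
  have s12 : coeff Φ 2 1 2 1 = coeff Φ 1 2 1 2 := by
    have hx : coeff Φ 1 2 1 2 = -(p / q) * (coeff Φ 1 1 1 1 + q ^ 2 * coeff Φ 1 1 2 2) := by
      field_simp
      linear_combination r1
    rw [← hsymm 1 2, hx]
    simp only [map_mul, map_neg, map_add, map_div₀, map_pow, conj_ofReal, hreal]
  have s02 : coeff Φ 2 0 2 0 = coeff Φ 0 2 0 2 := by
    have hx : coeff Φ 0 2 0 2 =
        -(coeff Φ 0 0 0 0 + coeff Φ 0 0 1 1 + coeff Φ 0 0 2 2 + coeff Φ 0 1 0 1) := by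
      linear_combination o0
    rw [← hsymm 0 2, hx]
    simp only [map_neg, map_add, hreal, hsymm, s01]
  obtain ⟨c, h00, h01, h10, h11, h12, h20, h21, h22, hx, hy, hw⟩ :=
    exists_eq_mul_of_system (d₀₀ := coeff Φ 0 0 0 0) (d₀₁ := coeff Φ 0 0 1 1)
    (d₁₀ := coeff Φ 1 1 0 0) (d₁₁ := coeff Φ 1 1 1 1) (d₁₂ := coeff Φ 1 1 2 2)
    (d₂₀ := coeff Φ 2 2 0 0) (d₂₁ := coeff Φ 2 2 1 1) (d₂₂ := coeff Φ 2 2 2 2)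
    (x := coeff Φ 0 1 0 1) (y := coeff Φ 1 2 1 2) (w := coeff Φ 0 2 0 2) hp' hq' hr ht
    (by linear_combination l0) (by linear_combination l1 - q * p * s01)
    (by linear_combination l0' - q * p * s01) (by linear_combination l1')
    (by linear_combination r1) (by linear_combination r2 - p * q * s12)
    (by linear_combination r1' - p * q * s12) (by linear_combination o0 - c02)
    (by linear_combination o1 - s01) (by linear_combination o2 - s02 - s12)
    (by linear_combination o1' - s12)
  have hcoeff : ∀ i j k l, coeff Φ i j k l = c * coeff (Psi p q) i j k l := fun i j k l => by
    by_cases h1 : i = j ∧ k = l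
    · obtain ⟨rfl, rfl⟩ := h1
      fin_cases i <;> fin_cases k <;>
        simp [coeff_Psi_diag, h00, h01, h10, h11, h12, h20, h21, h22, c02]
    by_cases h2 : i = k ∧ j = l
    · obtain ⟨rfl, rfl⟩ := h2
      fin_cases i <;> fin_cases j <;>
        simp [coeff_Psi_offDiag, s01, s02, s12, hx, hy, hw] at h1 ⊢
    rw [h.coeff_eq_zero hp hq hpq h1 h2, coeff_Psi_eq_zero h1 h2, mul_zero]
  have hΦ : Φ = c • Psi p q := by
    refine LinearMap.ext fun Z => ?_
    ext i j
    rw [LinearMap.smul_apply, Matrix.smul_apply, apply_eq_sum_coeff, apply_eq_sum_coeff,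
      smul_eq_mul, Finset.mul_sum]
    simp only [hcoeff, Finset.mul_sum, mul_assoc]
  -- In the order on `ℂ`, this gives both that `c` is real and that it is nonnegative.
  have hc : 0 ≤ c := by
    have hsingle : (Matrix.single 1 1 1 : Matrix (Fin 3) (Fin 3) ℂ).PosSemidef := by
      rw [← Matrix.diagonal_single]
      exact .diagonal fun i => by fin_cases i <;> simp
    have hpos : 0 ≤ coeff Φ 1 1 1 1 := (h.pos.2 _ hsingle).diag_nonneg
    have hD : (0 : ℂ) < ((q ^ 2 * (p * q - 1) ^ 2 : ℝ) : ℂ) := by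
      have : p * q - 1 ≠ 0 := by linarith
      rw [zero_lt_real]
      positivity
    rw [h11] at hpos
    refine le_of_mul_le_mul_right ?_ hD
    rw [zero_mul]
    exact_mod_cast hpos
  obtain ⟨hre, him⟩ := Complex.nonneg_iff.1 hc
  have hcr : c = (c.re : ℂ) := Complex.ext rfl (by simpa using him.symm)
  exact ⟨c.re, hre, hcr ▸ hΦ⟩

variable {p q : ℝ}

theorem Psi_ne_zero (hq : q ≠ 0) (hpq : p * q < 1) : Psi p q ≠ 0 := fun h0 => by
  have h1 := coeff_Psi_diag p q 1 1
  rw [coeff, h0] at h1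
  have : q ^ 2 * (p * q - 1) ^ 2 = 0 := by
    simp only [LinearMap.zero_apply, Matrix.zero_apply, Matrix.of_apply, Matrix.cons_val] at h1
    exact_mod_cast h1.symm
  have h2 : p * q - 1 ≠ 0 := by linarith
  simp [hq, h2] at this

theorem Admissible.isExtremePositive_Psi (h : Admissible p q) : IsExtremePositive (Psi p q) := by
  refine ⟨h.isPositive_Psi, Psi_ne_zero h.q_pos.ne' h.pq_lt, fun Φ₁ Φ₂ h₁ h₂ hsum => ?_⟩
  obtain ⟨a, ha, hΦ₁⟩ :=
    (HasPsiZeros.of_add h₁ h₂ hsum).exists_eq_smul h.p_pos h.q_pos h.pq_lt h.le_two_mul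
  obtain ⟨b, hb, hΦ₂⟩ := (HasPsiZeros.of_add h₂ h₁ (hsum.trans (add_comm _ _))).exists_eq_smul
    h.p_pos h.q_pos h.pq_lt h.le_two_mul
  exact ⟨a, b, ha, hb, hΦ₁, hΦ₂⟩

/-! ### Complete positivity and the Choi matrix -/

/-- If the maximally entangled projection is tested against a vector supported on two basis
vectors, only a `2 × 2` minor of the Choi matrix enters. -/
theorem IsCompletelyPositive.minor_nonneg
    {Φ : Matrix (Fin 3) (Fin 3) ℂ →ₗ[ℂ] Matrix (Fin 3) (Fin 3) ℂ} (h : IsCompletelyPositive Φ)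
    (r s : Fin 3 × Fin 3) (a b : ℝ) :
    0 ≤ a ^ 2 * coeff Φ r.1 r.1 r.2 r.2 + a * b * coeff Φ r.1 s.1 r.2 s.2
      + a * b * coeff Φ s.1 r.1 s.2 r.2 + b ^ 2 * coeff Φ s.1 s.1 s.2 s.2 := by
  let v : Fin 3 × Fin 3 → ℂ := fun x => if x.1 = x.2 then 1 else 0
  have hv := (h 3).2 _ (Matrix.posSemidef_vecMulVec_self_star v)
  have hblock : ∀ k l : Fin 3, (Matrix.of fun i j => Matrix.vecMulVec v (star v) (i, k) (j, l)) =
      Matrix.single k l (1 : ℂ) := fun k l => by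
    ext i j
    simp only [v, Matrix.of_apply, Matrix.vecMulVec_apply, Pi.star_apply, Matrix.single_apply,
      eq_comm (a := k), eq_comm (a := l)]
    split_ifs <;> simp_all
  have happ : ∀ x y : Fin 3 × Fin 3, ampliation (Fin 3) Φ (Matrix.vecMulVec v (star v)) x y =
      coeff Φ x.1 y.1 x.2 y.2 := fun x y => by
    rw [coeff, ← hblock]
    rfl
  have := hv.dotProduct_mulVec_nonneg (Pi.single r (a : ℂ) + Pi.single s (b : ℂ))
  refine this.trans_eq ?_
  rw [Matrix.mulVec_add, star_add, add_dotProduct, dotProduct_add, dotProduct_add]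
  simp only [Pi.star_single, single_dotProduct, Matrix.mulVec_single, Pi.smul_apply,
    Matrix.col_apply, happ, MulOpposite.smul_eq_mul_unop, MulOpposite.unop_op, RCLike.star_def, conj_ofReal]
  ring

theorem Admissible.not_isCompletelyPositive_Psi (h : Admissible p q) (hne : q ≠ 2 * p) :
    ¬ IsCompletelyPositive (Psi p q) := fun hcp => by
  -- The weights `q, p` make the two diagonal contributions equal; the sum is then negative because
  -- `(1 - p * q) ^ 2 < 1 - q ^ 2 + p ^ 2 * q ^ 2`.
  have h1 := hcp.minor_nonneg (0, 0) (1, 1) q p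
  simp only [coeff_Psi_diag, coeff_Psi_offDiag p q (show (0 : Fin 3) ≠ 1 by decide),
    coeff_Psi_offDiag p q (show (1 : Fin 3) ≠ 0 by decide), Matrix.of_apply, Matrix.cons_val] at h1
  have h2 : 0 ≤ -(2 * (p * q) ^ 2 * (q * (2 * p - q))) := by
    rw [← zero_le_real]
    refine h1.trans_eq ?_
    push_cast
    ring
  have h3 : 0 < 2 * p - q := sub_pos.2 (lt_of_le_of_ne h.le_two_mul hne)
  have := h.p_pos
  have := h.q_pos
  have : 0 < 2 * (p * q) ^ 2 * (q * (2 * p - q)) := by positivity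
  linarith

theorem Admissible.not_isCoCompletelyPositive_Psi (h : Admissible p q) :
    ¬ IsCoCompletelyPositive (Psi p q) := fun hcp => by
  have hT : ∀ i j k l, coeff ((Matrix.transposeLinearEquiv (Fin 3) (Fin 3) ℂ ℂ).toLinearMap ∘ₗ
      Psi p q) i j k l = coeff (Psi p q) j i k l := fun i j k l => rfl
  -- Transposition moves the entry `a` to the block `(0, 1), (1, 0)`; the weights `p * q, 1` again
  -- balance its diagonal.
  have h1 := IsCompletelyPositive.minor_nonneg hcp (0, 1) (1, 0) (p * q) 1
  simp only [hT, coeff_Psi_diag, coeff_Psi_offDiag p q (show (0 : Fin 3) ≠ 1 by decide),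
    coeff_Psi_offDiag p q (show (1 : Fin 3) ≠ 0 by decide), Matrix.of_apply, Matrix.cons_val] at h1
  have h2 : 0 ≤ -(2 * (p * q) ^ 2 * (1 - p * q) ^ 2) := by
    rw [← zero_le_real]
    refine h1.trans_eq ?_
    push_cast
    ring
  have := h.pq_pos
  have : 0 < 1 - p * q := by linarith [h.pq_lt]
  have : 0 < 2 * (p * q) ^ 2 * (1 - p * q) ^ 2 := by positivity
  linarith

theorem isCompletelyPositive_of_eq_mul_mul {m n : Type*} [Finite m] [Fintype n]
    {Φ : Matrix n n ℂ →ₗ[ℂ] Matrix m m ℂ} (K : Matrix m n ℂ) (h : ∀ Z, Φ Z = K * Z * Kᴴ) :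
    IsCompletelyPositive Φ := fun k => by
  have hamp : ∀ M, ampliation (Fin k) Φ M =
      K ⊗ₖ (1 : Matrix (Fin k) (Fin k) ℂ) * M * (K ⊗ₖ (1 : Matrix (Fin k) (Fin k) ℂ))ᴴ :=
    fun M => by
    ext ⟨i, r⟩ ⟨j, s⟩
    change Φ _ i j = _
    rw [h]
    simp [Matrix.mul_apply, Fintype.sum_prod_type, Matrix.one_apply, apply_ite]
  refine ⟨fun Z => ?_, fun Z hZ => ?_⟩
  · rw [hamp, hamp]
    simp [Matrix.mul_assoc]
  · rw [hamp]
    exact hZ.mul_mul_conjTranspose_same _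

/-- The Kraus operator of `Ψ_{p,2p}`. -/
def krausOperator (p : ℝ) : Matrix (Fin 3) (Fin 3) ℂ :=
  ((p * (1 - 2 * p ^ 2) : ℝ) : ℂ) • Matrix.diagonal ![1, -2, 1]

theorem Psi_two_mul (p : ℝ) (Z : Matrix (Fin 3) (Fin 3) ℂ) :
    Psi p (2 * p) Z = krausOperator p * Z * (krausOperator p)ᴴ := by
  ext i j
  rw [krausOperator, Matrix.conjTranspose_smul, Matrix.diagonal_conjTranspose]
  fin_cases i <;> fin_cases j <;>
    simp [Psi, Matrix.mul_apply, map_ofNat (starRingEnd ℂ) 2, Matrix.diagonal_apply] <;> ring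

theorem isKrausRank_one_of_eq_mul_mul {m n : Type*} [Fintype n]
    {Φ : Matrix n n ℂ →ₗ[ℂ] Matrix m m ℂ} (h0 : Φ ≠ 0) (K : Matrix m n ℂ)
    (h : ∀ Z, Φ Z = K * Z * Kᴴ) : IsKrausRank Φ 1 := by
  refine ⟨⟨fun _ => K, fun Z => by simp [h]⟩, fun r hr => ?_⟩
  obtain ⟨A, hA⟩ := hr
  refine Nat.one_le_iff_ne_zero.2 ?_
  rintro rfl
  exact h0 (LinearMap.ext fun Z => by simp [hA])

end QuantumMap

theorem theorem3p2 (p q : ℝ) (hpq : (p, q) ∈ QuantumMap.region) :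
    QuantumMap.IsExtremePositive (QuantumMap.Psi p q) ∧
    (q ≠ 2 * p →
      ¬ QuantumMap.IsCompletelyPositive (QuantumMap.Psi p q) ∧
      ¬ QuantumMap.IsCoCompletelyPositive (QuantumMap.Psi p q)) ∧
    (q = 2 * p →
      QuantumMap.IsCompletelyPositive (QuantumMap.Psi p q) ∧
      QuantumMap.IsKrausRank (QuantumMap.Psi p q) 1) := by
  have h := QuantumMap.admissible_of_mem_region hpq
  refine ⟨h.isExtremePositive_Psi, fun hne => ⟨h.not_isCompletelyPositive_Psi hne,
    h.not_isCoCompletelyPositive_Psi⟩, ?_⟩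
  rintro rfl
  exact ⟨QuantumMap.isCompletelyPositive_of_eq_mul_mul _ (QuantumMap.Psi_two_mul p),
    QuantumMap.isKrausRank_one_of_eq_mul_mul (QuantumMap.Psi_ne_zero h.q_pos.ne' h.pq_lt) _
      (QuantumMap.Psi_two_mul p)⟩
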